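/- For $\zeta=(\xi,\eta)\in\mathbb R^2$ and $\tau\in\mathbb R$ let $\mathcal F$ be the Fourier transform on $\mathbb R^2\times\mathbb R$ with kernel $e^{-i(x\xi+y\eta+t\tau)}$, let $\langle a\rangle=(1+|a|^2)^{1/2}$, let $D^\alpha$ be the Fourier multiplier with symbol $|\zeta|^\alpha$, and let $X_{s,b}$ be the space of tempered distributions $u$ on $\mathbb R^2\times\mathbb R$ with $$\|u\|_{X_{s,b}}=\big\|\langle\zeta\rangle^{s}\,\langle\tau-(\xi^3+\eta^3)\rangle^{b}\,\mathcal F(u)(\xi,\eta,\tau)\big\|_{L^2_{\xi,\eta,\tau}}<\infty .$$ Let $\varepsilon>0$, $A\ge 1$ and $K>A^2$. There is a constant $C>0$, depending only on $\varepsilon,A,K$, such that the following holds for all $N_1,N_2>0$ with $KN_1<N_2$. If $u,v\in X_{0,\frac12+\varepsilon}$, $\operatorname{supp}\mathcal F(u)\subset\{A^{-1}N_1\le|\zeta|\le AN_1\}$ and $\operatorname{supp}\mathcal F(v)\subset\{A^{-1}N_2\le|\zeta|\le AN_2\}$, then $D^{-1/2}u$, $Dv$, $u$ and $v$ are functions,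 and $$\|D^{-\frac12}u\,Dv\|_{L^2_{x,y,t}}\le C\,\|u\|_{X_{0,\frac12+\varepsilon}}\|v\|_{X_{0,\frac12+\varepsilon}},$$ $$\|uv\|_{L^2_{x,y,t}}\le C\,\frac{N_1^{1/2}}{N_2}\,\|u\|_{X_{0,\frac12+\varepsilon}}\|v\|_{X_{0,\frac12+\varepsilon}} .$$ -/

import Mathlib

open MeasureTheory SchwartzMap FourierTransform
open scoped ENNReal

noncomputable section

namespace ZK

/-- Space-time `ℝ² × ℝ`, with coordinates `p 0 = x`, `p 1 = y`, `p 2 = t`. The same space carries the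
dual variables `w 0 = ξ`, `w 1 = η`, `w 2 = τ`. Its `volume` is Lebesgue measure. -/
abbrev Spacetime : Type := EuclideanSpace ℝ (Fin 3)

/-- The Japanese bracket `⟨r⟩ = (1 + r²)^{1/2}`. -/
def bracket (r : ℝ) : ℝ := Real.sqrt (1 + r ^ 2)

/-- The size `|ζ|` of the spatial frequency `ζ = (ξ, η)`. -/
def freq (w : Spacetime) : ℝ := Real.sqrt (w 0 ^ 2 + w 1 ^ 2)

/-- The modulation `τ - (ξ³ + η³)`. -/
def modulation (w : Spacetime) : ℝ := w 2 - (w 0 ^ 3 + w 1 ^ 3)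

/-- The dilation `w ↦ (2π)⁻¹ w`. -/
def dilation : Spacetime ≃L[ℝ] Spacetime :=
  ContinuousLinearEquiv.smulLeft (Units.mk0 ((2 * Real.pi)⁻¹ : ℝ) (inv_ne_zero Real.two_pi_pos.ne'))

/-- The space-time Fourier transform with kernel `e^{-i(xξ + yη + tτ)}` (no prefactor) on Schwartz
functions: Mathlib's transform, whose kernel is `e^{-2πi(xξ + yη + tτ)}`, evaluated
at `(2π)⁻¹ w`. -/
def fourierSchwartz : 𝓢(Spacetime, ℂ) →L[ℂ] 𝓢(Spacetime, ℂ) :=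
  (SchwartzMap.compCLMOfContinuousLinearEquiv ℂ dilation) ∘L (fourierCLM ℂ 𝓢(Spacetime, ℂ))

/-- The space-time Fourier transform, with kernel `e^{-i(xξ + yη + tτ)}`, of a tempered distribution,
defined by duality. -/
def fourierDist (u : 𝓢'(Spacetime, ℂ)) : 𝓢'(Spacetime, ℂ) :=
  PointwiseConvergenceCLM.precomp ℂ fourierSchwartz u

/-- The tempered distribution `u` is (integration against) the function `f`. Such an `f` is
unique up to null sets. -/
def IsFunction (u : 𝓢'(Spacetime, ℂ)) (f : Spacetime → ℂ) : Prop :=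
  AEStronglyMeasurable f volume ∧
    ∀ φ : 𝓢(Spacetime, ℂ), Integrable (fun p => φ p * f p) ∧ u φ = ∫ p, φ p * f p

/-- The norm `‖u‖_{X_{s,b}} = ‖⟨ζ⟩^s ⟨τ - (ξ³ + η³)⟩^b F(u)‖_{L²}` of a tempered distribution; it is
`∞` if `F(u)` is not a function. The infimum is over the functions representing `F(u)`,
all of which agree almost everywhere. -/
def bourgainNorm (s b : ℝ) (u : 𝓢'(Spacetime, ℂ)) : ℝ≥0∞ :=
  ⨅ (G : Spacetime → ℂ) (_ : IsFunction (fourierDist u) G),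
    eLpNorm (fun w => ((bracket (freq w) ^ s * bracket (modulation w) ^ b : ℝ) : ℂ) * G w) 2 volume

/-- The Bourgain space `X_{s,b}`. -/
def bourgainSpace (s b : ℝ) : Set 𝓢'(Spacetime, ℂ) := {u | bourgainNorm s b u < ∞}

/-- `u' = D^α u`, where `D^α` is the Fourier multiplier with symbol `|ζ|^α`: `F(u)` is a
function `G`, and `F(u')` is the function `|ζ|^α G`. For given `u` there is at most one `u'`. -/
def IsFracDeriv (α : ℝ) (u u' : 𝓢'(Spacetime, ℂ)) : Prop :=
  ∃ G : Spacetime → ℂ, IsFunction (fourierDist u) G ∧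
    IsFunction (fourierDist u') (fun w => ((freq w ^ α : ℝ) : ℂ) * G w)

/-- `u` is supported on spatial frequencies `|ζ| ∼ N` with implied constant `A`: the support of the
distribution `F(u)` lies in `{A⁻¹ N ≤ |ζ| ≤ A N}`. -/
def FreqSupported (A N : ℝ) (u : 𝓢'(Spacetime, ℂ)) : Prop :=
  Distribution.dsupport (fourierDist u) ⊆ {w : Spacetime | A⁻¹ * N ≤ freq w ∧ freq w ≤ A * N}

end ZK

end

noncomputable section

namespace ZK

/-! By Plancherel the product of `u` and `v` is controlled by the `L²` norm of the convolution of
their Fourier transforms `G` and `H`. Write each as a reciprocal modulation weight on its annulus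
times an `L²` function. Cauchy–Schwarz at each output frequency `w` (`lintegral_convolution_sq_le`)
reduces everything to a bound, uniform in `w`, for the convolution of the squared weights.

At fixed `w = (ξ, η, τ)`, the low frequency being `(x, y)`, the phase is `x³ + (ξ - x)³ + y³ + (η -
y)³`. It splits into one function of `x` and one of `y`, with derivatives `3x² - 3(ξ - x)²` and `3y²
- 3(η - y)²`. Up to sign they add up to three times the difference of the squared high and low
frequencies, which is at least a multiple of `N₂²` because `A² < K`; so one of them is that large
(`mem_steepSet_or`). Taking the phase as new variable in that direction gains `N₂⁻²`, and the other
coordinate of the low frequency ranges over an interval of length `2AN₁` (`lintegral_resonance_le`).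
The square root of `N₁ / N₂²` is the factor in the second estimate.

The first estimate is the same bound applied to `D^{-1/2}u` and `Dv`, whose norms cost `N₁^{-1/2}`
and `N₂`. Localization to an annulus makes all the Fourier transforms integrable, so the
distributions are functions given by inverse Fourier integrals, and their products are pointwise. -/

/-! ### Functions representing tempered distributions -/

/-- A function whose product with every Schwartz function is integrable is locally integrable. -/
theorem locallyIntegrable_of_schwartz {G : Spacetime → ℂ}
    (h : ∀ φ : 𝓢(Spacetime, ℂ), Integrable (fun p => φ p * G p)) : LocallyIntegrable G := by
  intro x
  -- The bump equals 1 on the unit ball around `x`, so there `G` agrees with an integrable product.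
  let b : ContDiffBump x := ⟨1, 2, one_pos, one_lt_two⟩
  have hc : HasCompactSupport (Complex.ofRealCLM ∘ b) := b.hasCompactSupport.comp_left rfl
  have hd : ContDiff ℝ (↑(⊤ : ℕ∞)) (Complex.ofRealCLM ∘ b) :=
    Complex.ofRealCLM.contDiff.comp b.contDiff
  refine ⟨Metric.closedBall x 1, Metric.closedBall_mem_nhds x one_pos, ?_⟩
  refine ((h (hc.toSchwartzMap hd)).integrableOn (s := Metric.closedBall x 1)).congr_fun
    (fun y hy => ?_) measurableSet_closedBall
  have : b y = 1 := b.one_of_mem_closedBall hy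
  simp [this]

/-- A locally integrable function that annihilates all Schwartz functions supported in an open set
vanishes almost everywhere there. -/
theorem ae_eq_zero_of_integral_schwartz {G : Spacetime → ℂ} (hG : LocallyIntegrable G)
    {U : Set Spacetime} (hU : IsOpen U)
    (h : ∀ φ : 𝓢(Spacetime, ℂ), tsupport φ ⊆ U → ∫ p, φ p * G p = 0) :
    ∀ᵐ p, p ∈ U → G p = 0 := by
  refine hU.ae_eq_zero_of_integral_contDiff_smul_eq_zero (hG.locallyIntegrableOn U) ?_
  intro g hg hc hs
  have hc' : HasCompactSupport (Complex.ofRealCLM ∘ g) := hc.comp_left rfl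
  have hd : ContDiff ℝ (↑(⊤ : ℕ∞)) (Complex.ofRealCLM ∘ g) := Complex.ofRealCLM.contDiff.comp hg
  have hs' : tsupport (Complex.ofRealCLM ∘ g) ⊆ U :=
    (tsupport_comp_subset (map_zero Complex.ofRealCLM) g).trans hs
  have := h (hc'.toSchwartzMap hd) hs'
  simpa using this

theorem IsFunction.locallyIntegrable {u : 𝓢'(Spacetime, ℂ)} {G : Spacetime → ℂ}
    (h : IsFunction u G) : LocallyIntegrable G :=
  locallyIntegrable_of_schwartz fun φ => (h.2 φ).1

theorem ae_eq_of_integral_schwartz_eq {G H : Spacetime → ℂ}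
    (hG : ∀ φ : 𝓢(Spacetime, ℂ), Integrable (fun p => φ p * G p))
    (hH : ∀ φ : 𝓢(Spacetime, ℂ), Integrable (fun p => φ p * H p))
    (h : ∀ φ : 𝓢(Spacetime, ℂ), ∫ p, φ p * G p = ∫ p, φ p * H p) : G =ᵐ[volume] H := by
  have := ae_eq_zero_of_integral_schwartz (G := G - H)
    ((locallyIntegrable_of_schwartz hG).sub (locallyIntegrable_of_schwartz hH)) isOpen_univ
    (fun φ _ => by
      simp only [Pi.sub_apply, mul_sub]
      rw [integral_sub (hG φ) (hH φ), h, sub_self])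
  filter_upwards [this] with p hp
  exact sub_eq_zero.mp (hp trivial)

theorem IsFunction.ae_eq {u : 𝓢'(Spacetime, ℂ)} {G H : Spacetime → ℂ}
    (hG : IsFunction u G) (hH : IsFunction u H) : G =ᵐ[volume] H :=
  ae_eq_of_integral_schwartz_eq (fun φ => (hG.2 φ).1) (fun φ => (hH.2 φ).1)
    fun φ => (hG.2 φ).2.symm.trans (hH.2 φ).2

theorem IsFunction.congr {u : 𝓢'(Spacetime, ℂ)} {G H : Spacetime → ℂ}
    (hG : IsFunction u G) (h : G =ᵐ[volume] H) : IsFunction u H := by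
  refine ⟨hG.1.congr h, fun φ => ?_⟩
  have : (fun p => φ p * G p) =ᵐ[volume] fun p => φ p * H p := by
    filter_upwards [h] with p hp
    rw [hp]
  exact ⟨(hG.2 φ).1.congr this, (hG.2 φ).2.trans (integral_congr_ae this)⟩

/-- A function representing a tempered distribution vanishes almost everywhere off the support. -/
theorem IsFunction.ae_eq_zero {u : 𝓢'(Spacetime, ℂ)} {G : Spacetime → ℂ}
    (hG : IsFunction u G) : ∀ᵐ p, p ∉ Distribution.dsupport u → G p = 0 := by
  rw [ae_iff]
  -- Each point off the support has an open neighbourhood on which the distribution vanishes; local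
  -- nullity then suffices.
  refine measure_null_of_locally_null _ fun x hx => ?_
  simp only [Set.mem_ofPred_eq, Classical.not_imp] at hx
  obtain ⟨U, hv, hU, hxU⟩ := (Distribution.notMem_dsupport_iff x).1 hx.1
  refine ⟨{p | p ∈ U ∧ G p ≠ 0}, ?_, ?_⟩
  · filter_upwards [self_mem_nhdsWithin, mem_nhdsWithin_of_mem_nhds (hU.mem_nhds hxU)] with y hy hyU
    simp only [Classical.not_imp] at hy
    exact ⟨hyU, hy.2⟩
  · have := ae_eq_zero_of_integral_schwartz hG.locallyIntegrable hU
      fun φ hφ => (hG.2 φ).2.symm.trans (hv φ hφ)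
    rw [ae_iff] at this
    simpa only [Classical.not_imp] using this

/-- The Bourgain norm is computed by any representative of the Fourier transform. -/
theorem bourgainNorm_eq {s b : ℝ} {u : 𝓢'(Spacetime, ℂ)} {G : Spacetime → ℂ}
    (hG : IsFunction (fourierDist u) G) :
    bourgainNorm s b u = eLpNorm
      (fun w => ((bracket (freq w) ^ s * bracket (modulation w) ^ b : ℝ) : ℂ) * G w) 2 volume := by
  refine le_antisymm (iInf₂_le G hG) (le_iInf₂ fun H hH => le_of_eq (eLpNorm_congr_ae ?_))
  filter_upwards [hG.ae_eq hH] with w hw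
  rw [hw]

theorem exists_isFunction_of_mem_bourgainSpace {s b : ℝ} {u : 𝓢'(Spacetime, ℂ)}
    (hu : u ∈ bourgainSpace s b) : ∃ G, IsFunction (fourierDist u) G := by
  have : bourgainNorm s b u < ∞ := hu
  simp only [bourgainNorm, iInf_lt_iff] at this
  obtain ⟨G, hG, -⟩ := this
  exact ⟨G, hG⟩

/-! ### Fourier inversion, Plancherel and products -/

theorem integrable_schwartz_mul {G : Spacetime → ℂ} (hG : Integrable G) (φ : 𝓢(Spacetime, ℂ)) :
    Integrable (fun p => φ p * G p) :=
  hG.bdd_mul (c := SchwartzMap.seminorm ℝ 0 0 φ) φ.continuous.aestronglyMeasurable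
    (Filter.Eventually.of_forall fun x => norm_le_seminorm ℝ φ x)

theorem integrable_schwartz_mul_of_memLp_two {G : Spacetime → ℂ} (hG : MemLp G 2)
    (φ : 𝓢(Spacetime, ℂ)) : Integrable (fun p => φ p * G p) :=
  (φ.memLp 2).integrable_mul hG

theorem fourierInv_continuous {G : Spacetime → ℂ} (hG : Integrable G) : Continuous (𝓕⁻ G) := by
  rw [show 𝓕⁻ G = fun x => 𝓕 G (-x) from funext fun x => Real.fourierInv_eq_fourier_neg G x]
  exact (VectorFourier.fourierIntegral_continuous Real.continuous_fourierChar
    (by exact continuous_inner) hG).comp continuous_neg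

theorem norm_fourierInv_le {G : Spacetime → ℂ} (x : Spacetime) : ‖𝓕⁻ G x‖ ≤ ∫ w, ‖G w‖ := by
  rw [Real.fourierInv_eq_fourier_neg]
  exact VectorFourier.norm_fourierIntegral_le_integral_norm _ _ _ _ _

theorem integrable_schwartz_mul_of_bounded {f : Spacetime → ℂ} (hf : AEStronglyMeasurable f volume)
    {B : ℝ} (hB : ∀ x, ‖f x‖ ≤ B) (φ : 𝓢(Spacetime, ℂ)) : Integrable (fun p => φ p * f p) := by
  simpa only [mul_comm] using
    φ.integrable.bdd_mul (c := B) hf (Filter.Eventually.of_forall hB)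

/-- Fubini for the Fourier kernel; reversing the sign of the inner product turns the forward
transform into the inverse one. -/
theorem integral_fourierInv_mul_eq_integrable {G : Spacetime → ℂ} (hG : Integrable G)
    (χ : 𝓢(Spacetime, ℂ)) : ∫ w, (𝓕⁻ χ) w * G w = ∫ p, χ p * 𝓕⁻ G p := by
  have hc : Continuous fun p : Spacetime × Spacetime => (-innerₗ Spacetime) p.1 p.2 :=
    (continuous_inner (𝕜 := ℝ) (E := Spacetime)).neg
  have h := VectorFourier.integral_fourierIntegral_smul_eq_flip (μ := volume) (ν := volume)
    (L := -innerₗ Spacetime) (f := χ) (g := G) Real.continuous_fourierChar hc χ.integrable hG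
  have h1 : ∀ w, VectorFourier.fourierIntegral Real.fourierChar volume (-innerₗ Spacetime) χ w =
      (𝓕⁻ χ) w := fun w => by
    rw [SchwartzMap.fourierInv_coe, Real.fourierInv_eq]
    simp [VectorFourier.fourierIntegral]
  have h2 : ∀ p, VectorFourier.fourierIntegral Real.fourierChar volume (-innerₗ Spacetime).flip G p
      = 𝓕⁻ G p := fun p => by
    rw [Real.fourierInv_eq]
    simp [VectorFourier.fourierIntegral, real_inner_comm]
  simpa only [h1, h2, smul_eq_mul] using h

/-- The inverse of the Fourier transform with kernel `e^{-i(xξ + yη + tτ)}`, for functions. -/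
def invFourier (G : Spacetime → ℂ) (p : Spacetime) : ℂ :=
  (((2 * Real.pi) ^ 3)⁻¹ : ℝ) * 𝓕⁻ G ((2 * Real.pi)⁻¹ • p)

/-- The inverse of `fourierSchwartz`. -/
def invFourierSchwartz : 𝓢(Spacetime, ℂ) →L[ℂ] 𝓢(Spacetime, ℂ) :=
  (fourierInvCLM ℂ 𝓢(Spacetime, ℂ)) ∘L
    (SchwartzMap.compCLMOfContinuousLinearEquiv ℂ dilation.symm)

theorem fourierSchwartz_invFourierSchwartz (ψ : 𝓢(Spacetime, ℂ)) :
    fourierSchwartz (invFourierSchwartz ψ) = ψ := by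
  ext p
  simp [fourierSchwartz, invFourierSchwartz]

theorem invFourierSchwartz_fourierSchwartz (ψ : 𝓢(Spacetime, ℂ)) :
    invFourierSchwartz (fourierSchwartz ψ) = ψ := by
  have : SchwartzMap.compCLMOfContinuousLinearEquiv ℂ dilation.symm
      (SchwartzMap.compCLMOfContinuousLinearEquiv ℂ dilation (𝓕 ψ)) = 𝓕 ψ := by
    ext p
    simp
  simp [fourierSchwartz, invFourierSchwartz, this]

theorem fourierDist_apply (u : 𝓢'(Spacetime, ℂ)) (φ : 𝓢(Spacetime, ℂ)) :
    fourierDist u φ = u (fourierSchwartz φ) := rfl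

theorem dilation_symm_apply (p : Spacetime) : dilation.symm p = (2 * Real.pi) • p := by
  rw [ContinuousLinearEquiv.symm_apply_eq]
  exact (inv_smul_smul₀ Real.two_pi_pos.ne' p).symm

/-- If the Fourier transform of `u` is an integrable function, then `u` is the function given by
the inverse Fourier integral. -/
theorem IsFunction.of_fourierDist {u : 𝓢'(Spacetime, ℂ)} {G : Spacetime → ℂ} (hG : Integrable G)
    (h : IsFunction (fourierDist u) G) : IsFunction u (invFourier G) := by
  have hm : AEStronglyMeasurable (invFourier G) volume :=
    (continuous_const.mul ((fourierInv_continuous hG).comp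
      (continuous_const_smul _))).aestronglyMeasurable
  refine ⟨hm, fun ψ => ⟨integrable_schwartz_mul_of_bounded hm
    (B := ‖((((2 * Real.pi) ^ 3)⁻¹ : ℝ) : ℂ)‖ * ∫ w, ‖G w‖) (fun x => ?_) ψ, ?_⟩⟩
  · rw [invFourier, norm_mul]
    exact mul_le_mul_of_nonneg_left (norm_fourierInv_le _) (norm_nonneg _)
  have h1 : u ψ = fourierDist u (invFourierSchwartz ψ) := by
    rw [fourierDist_apply, fourierSchwartz_invFourierSchwartz]
  have h2 : ∀ w, invFourierSchwartz ψ w =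
      (𝓕⁻ (SchwartzMap.compCLMOfContinuousLinearEquiv ℂ dilation.symm ψ)) w := fun w => rfl
  have hpi : (2 * Real.pi) ≠ 0 := Real.two_pi_pos.ne'
  rw [h1, (h.2 _).2]
  simp only [h2]
  rw [integral_fourierInv_mul_eq_integrable hG]
  -- The Jacobian of `p ↦ 2πp` on a 3-dimensional space produces the prefactor `(2π)⁻³` of
  -- `invFourier`.
  have h3 := Measure.integral_comp_smul (volume : Measure Spacetime)
    (fun p => ψ p * 𝓕⁻ G ((2 * Real.pi)⁻¹ • p)) (2 * Real.pi)
  have h4 : Module.finrank ℝ Spacetime = 3 := by simp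
  rw [h4, abs_of_pos (by positivity)] at h3
  calc _ = ∫ p : Spacetime, ψ ((2 * Real.pi) • p) *
          𝓕⁻ G ((2 * Real.pi)⁻¹ • (2 * Real.pi) • p) := by
        congr 1; ext p
        rw [inv_smul_smul₀ hpi, ← dilation_symm_apply]
        rfl
    _ = _ := by
        rw [h3, Complex.real_smul, ← integral_const_mul]
        congr 1; ext p
        rw [invFourier]; ring

/-- Every integrable function is the Fourier transform of a tempered distribution. -/
theorem exists_fourierDist_isFunction {G : Spacetime → ℂ} (hG : Integrable G) :
    ∃ u : 𝓢'(Spacetime, ℂ), IsFunction (fourierDist u) G := by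
  have : Fact ((1 : ℝ≥0∞) ≤ 1) := ⟨le_rfl⟩
  have hG' : MemLp G 1 := memLp_one_iff_integrable.2 hG
  refine ⟨PointwiseConvergenceCLM.precomp ℂ invFourierSchwartz
    (Lp.toTemperedDistribution (hG'.toLp G)), hG.1, fun φ => ⟨integrable_schwartz_mul hG φ, ?_⟩⟩
  have : fourierDist (PointwiseConvergenceCLM.precomp ℂ invFourierSchwartz
      (Lp.toTemperedDistribution (hG'.toLp G))) φ = Lp.toTemperedDistribution (hG'.toLp G)
      (invFourierSchwartz (fourierSchwartz φ)) := rfl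
  rw [this, invFourierSchwartz_fourierSchwartz, Lp.toTemperedDistribution_apply]
  refine integral_congr_ae ?_
  filter_upwards [hG'.coeFn_toLp] with p hp
  rw [hp, smul_eq_mul]

/-- Plancherel's inequality for integrable functions. -/
theorem eLpNorm_fourierInv_le {k : Spacetime → ℂ} (hk : Integrable k) :
    eLpNorm (𝓕⁻ k) 2 volume ≤ eLpNorm k 2 volume := by
  by_cases h : eLpNorm k 2 volume = ∞
  · simp [h]
  have hk2 : MemLp k 2 := ⟨hk.1, lt_top_iff_ne_top.2 h⟩
  -- The `L²` transform and the integral transform agree because they define the same tempered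
  -- distribution.
  have hae : (𝓕⁻ (hk2.toLp k) : Lp ℂ 2 (volume : Measure Spacetime)) =ᵐ[volume] 𝓕⁻ k := by
    refine ae_eq_of_integral_schwartz_eq
      (fun φ => integrable_schwartz_mul_of_memLp_two (Lp.memLp _) φ)
      (fun φ => integrable_schwartz_mul_of_bounded
        (fourierInv_continuous hk).aestronglyMeasurable norm_fourierInv_le φ) fun φ => ?_
    rw [← integral_fourierInv_mul_eq_integrable hk]
    have h1 := congrArg (fun T : 𝓢'(Spacetime, ℂ) => T φ)
      (Lp.fourierInv_toTemperedDistribution_eq (hk2.toLp k))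
    simp only [TemperedDistribution.fourierInv_apply, Lp.toTemperedDistribution_apply,
      smul_eq_mul] at h1
    rw [← h1]
    refine integral_congr_ae ?_
    filter_upwards [hk2.coeFn_toLp] with p hp
    rw [hp]
  have h2 : ‖(𝓕⁻ (hk2.toLp k) : Lp ℂ 2 (volume : Measure Spacetime))‖ = ‖hk2.toLp k‖ :=
    (Lp.fourierTransformₗᵢ Spacetime ℂ).symm.norm_map _
  rw [← eLpNorm_congr_ae hae, ← eLpNorm_congr_ae hk2.coeFn_toLp, ← Lp.enorm_def, ← Lp.enorm_def,
    ← ofReal_norm, ← ofReal_norm, h2]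

open scoped Convolution in
theorem fourierInv_convolution {G H : Spacetime → ℂ} (hG : Integrable G) (hH : Integrable H)
    (x : Spacetime) :
    𝓕⁻ (G ⋆[ContinuousLinearMap.mul ℂ ℂ] H) x = 𝓕⁻ G x * 𝓕⁻ H x := by
  simp only [Real.fourierInv_eq_fourier_neg]
  exact Real.fourier_mul_convolution_eq hG hH _

/-- The exact factor is `(2π)^{3/2}`. The cruder `(2π)³` is enough, since two inverse transforms
supply `(2π)⁻⁶`. -/
theorem eLpNorm_comp_inv_smul_le {f : Spacetime → ℂ} (hf : AEStronglyMeasurable f volume) :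
    eLpNorm (fun p => f ((2 * Real.pi)⁻¹ • p)) 2 volume ≤
      ENNReal.ofReal ((2 * Real.pi) ^ 3) * eLpNorm f 2 volume := by
  have hpi : (0 : ℝ) < 2 * Real.pi := Real.two_pi_pos
  have hmap := Measure.map_addHaar_smul (volume : Measure Spacetime) (inv_ne_zero hpi.ne')
  have h4 : Module.finrank ℝ Spacetime = 3 := by simp
  rw [h4, inv_pow, inv_inv, abs_of_pos (by positivity)] at hmap
  have h := eLpNorm_map_measure (p := 2) (f := fun x : Spacetime => (2 * Real.pi)⁻¹ • x)
    (g := f) (μ := volume) (by rw [hmap]; exact hf.smul_measure _)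
    (measurable_const_smul _).aemeasurable
  rw [hmap, eLpNorm_smul_measure_of_ne_top (by norm_num)] at h
  rw [← Function.comp_def f, ← h, smul_eq_mul]
  gcongr
  refine (ENNReal.rpow_le_rpow_of_exponent_le (z := 1) ?_ (by norm_num)).trans_eq
    (ENNReal.rpow_one _)
  rw [ENNReal.one_le_ofReal]
  exact one_le_pow₀ (by linarith [Real.pi_gt_three])

open scoped Convolution in
theorem eLpNorm_invFourier_mul_le {G H : Spacetime → ℂ} (hG : Integrable G) (hH : Integrable H) :
    eLpNorm (fun p => invFourier G p * invFourier H p) 2 volume ≤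
      eLpNorm (G ⋆[ContinuousLinearMap.mul ℂ ℂ] H) 2 volume := by
  have hk : Integrable (G ⋆[ContinuousLinearMap.mul ℂ ℂ] H) :=
    hG.integrable_convolution _ hH
  set k := G ⋆[ContinuousLinearMap.mul ℂ ℂ] H with hk_def
  set c : ℝ := (2 * Real.pi) ^ 3 with hc_def
  have hc : 1 ≤ c := one_le_pow₀ (by linarith [Real.pi_gt_three])
  have h1 : (fun p => invFourier G p * invFourier H p) =
      ((c⁻¹ * c⁻¹ : ℝ) : ℂ) • fun p => 𝓕⁻ k ((2 * Real.pi)⁻¹ • p) := by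
    ext p
    simp only [invFourier, Pi.smul_apply, hk_def, fourierInv_convolution hG hH, smul_eq_mul,
      ← hc_def]
    push_cast
    ring
  rw [h1, eLpNorm_const_smul]
  calc _ ≤ ‖((c⁻¹ * c⁻¹ : ℝ) : ℂ)‖ₑ * (ENNReal.ofReal c * eLpNorm k 2 volume) := by
        gcongr
        exact (eLpNorm_comp_inv_smul_le (fourierInv_continuous hk).aestronglyMeasurable).trans
          (mul_le_mul_right (eLpNorm_fourierInv_le hk) _)
    _ ≤ 1 * eLpNorm k 2 volume := by
        rw [← mul_assoc]
        gcongr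
        rw [← ofReal_norm, ← ENNReal.ofReal_mul (norm_nonneg _), ENNReal.ofReal_le_one,
          Complex.norm_real, Real.norm_of_nonneg (by positivity), mul_assoc,
          inv_mul_cancel₀ (by positivity), mul_one]
        exact inv_le_one_of_one_le₀ hc
    _ = _ := one_mul _

/-! ### Weighted convolution bound -/

/-- The Cauchy–Schwarz inequality for the Lebesgue integral, in squared form. -/
theorem lintegral_mul_sq_le {α : Type*} [MeasurableSpace α] (μ : Measure α) {f g : α → ℝ≥0∞}
    (hf : AEMeasurable f μ) (hg : AEMeasurable g μ) :
    (∫⁻ a, f a * g a ∂μ) ^ 2 ≤ (∫⁻ a, f a ^ 2 ∂μ) * ∫⁻ a, g a ^ 2 ∂μ := by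
  have h := ENNReal.lintegral_mul_le_Lp_mul_Lq μ Real.HolderConjugate.two_two hf hg
  simp only [ENNReal.rpow_two, Pi.mul_apply] at h
  calc _ ≤ ((∫⁻ a, f a ^ 2 ∂μ) ^ (1 / 2 : ℝ) * (∫⁻ a, g a ^ 2 ∂μ) ^ (1 / 2 : ℝ)) ^ 2 := by
        gcongr
    _ = _ := by
        rw [mul_pow, ← ENNReal.rpow_two, ← ENNReal.rpow_two, ← ENNReal.rpow_mul,
          ← ENNReal.rpow_mul]
        norm_num

theorem eLpNorm_two_sq {α : Type*} [MeasurableSpace α] {μ : Measure α} (f : α → ℂ) :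
    eLpNorm f 2 μ ^ 2 = ∫⁻ a, ‖f a‖ₑ ^ 2 ∂μ := by
  rw [eLpNorm_eq_lintegral_rpow_enorm_toReal two_ne_zero ENNReal.ofNat_ne_top,
    ← ENNReal.rpow_two, ← ENNReal.rpow_mul]
  norm_num

open scoped Convolution in
/-- An `L²` bound for a convolution of two functions factored through weights. -/
theorem lintegral_convolution_sq_le {G H : Spacetime → ℂ} {κ₁ κ₂ g₁ g₂ : Spacetime → ℝ≥0∞}
    (hκ₁ : Measurable κ₁) (hκ₂ : Measurable κ₂) (hg₁ : Measurable g₁) (hg₂ : Measurable g₂)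
    (hG : ∀ w, ‖G w‖ₑ ≤ κ₁ w * g₁ w) (hH : ∀ w, ‖H w‖ₑ ≤ κ₂ w * g₂ w) {M : ℝ≥0∞}
    (hM : ∀ w, ∫⁻ t, κ₁ t ^ 2 * κ₂ (w - t) ^ 2 ≤ M) :
    eLpNorm (G ⋆[ContinuousLinearMap.mul ℂ ℂ] H) 2 volume ^ 2 ≤
      M * ((∫⁻ t, g₁ t ^ 2) * ∫⁻ t, g₂ t ^ 2) := by
  rw [eLpNorm_two_sq]
  -- Cauchy–Schwarz in `t` with the weights in one factor, bounded by `M`; Tonelli then separates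
  -- the integrals of `g₁²` and `g₂²`.
  have h1 : ∀ w, ‖(G ⋆[ContinuousLinearMap.mul ℂ ℂ] H) w‖ₑ ^ 2 ≤
      M * ∫⁻ t, g₁ t ^ 2 * g₂ (w - t) ^ 2 := fun w => by
    have h2 : ‖(G ⋆[ContinuousLinearMap.mul ℂ ℂ] H) w‖ₑ ≤
        ∫⁻ t, (κ₁ t * κ₂ (w - t)) * (g₁ t * g₂ (w - t)) := by
      refine (enorm_integral_le_lintegral_enorm _).trans (lintegral_mono fun t => ?_)
      simp only [ContinuousLinearMap.mul_apply', enorm_mul]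
      exact (mul_le_mul' (hG t) (hH _)).trans_eq (mul_mul_mul_comm _ _ _ _)
    calc _ ≤ (∫⁻ t, (κ₁ t * κ₂ (w - t)) * (g₁ t * g₂ (w - t))) ^ 2 := by gcongr
      _ ≤ _ := lintegral_mul_sq_le _ (by fun_prop) (by fun_prop)
      _ ≤ _ := by
        simp only [mul_pow]
        gcongr
        exact hM w
  refine (lintegral_mono h1).trans ?_
  rw [lintegral_const_mul _ (by fun_prop), lintegral_lintegral_swap (by fun_prop)]
  gcongr
  refine le_of_eq ?_
  have h3 : ∀ t, ∫⁻ w, g₁ t ^ 2 * g₂ (w - t) ^ 2 = g₁ t ^ 2 * ∫⁻ w, g₂ w ^ 2 := fun t => by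
    rw [lintegral_const_mul _ (by fun_prop), lintegral_sub_right_eq_self (fun w => g₂ w ^ 2) t]
  simp only [h3]
  rw [lintegral_mul_const _ (by fun_prop)]

/-! ### Change of variables along the phase -/

theorem lintegral_spacetime {F : Spacetime → ℝ≥0∞} (hF : Measurable F) :
    ∫⁻ w, F w = ∫⁻ x : ℝ, ∫⁻ y : ℝ, ∫⁻ s : ℝ, F !₂[x, y, s] := by
  have h1 := (EuclideanSpace.volume_preserving_symm_measurableEquiv_toLp (Fin 3)).symm
  have h2 := (volume_preserving_piFinSuccAbove (fun _ : Fin 3 => ℝ) 0).symm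
  have h3 := (volume_preserving_finTwoArrow ℝ).symm
  have hF' : Measurable fun a : Fin 3 → ℝ => F (WithLp.toLp 2 a) :=
    hF.comp (MeasurableEquiv.toLp 2 (Fin 3 → ℝ)).measurable
  refine (h1.lintegral_comp hF).symm.trans ((h2.lintegral_comp hF').symm.trans ?_)
  refine (lintegral_prod _ (hF'.comp (MeasurableEquiv.measurable _)).aemeasurable).trans ?_
  refine lintegral_congr fun x => ?_
  have hF'' : Measurable fun a : Fin 2 → ℝ => F (WithLp.toLp 2
      ((MeasurableEquiv.piFinSuccAbove (fun _ : Fin 3 => ℝ) 0).symm (x, a))) :=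
    hF'.comp ((MeasurableEquiv.measurable _).comp (by fun_prop))
  refine (h3.lintegral_comp hF'').symm.trans ?_
  refine (lintegral_prod _ (hF''.comp (MeasurableEquiv.measurable _)).aemeasurable).trans ?_
  refine lintegral_congr fun y => lintegral_congr fun s => congrArg F ?_
  ext i
  fin_cases i <;> rfl

/-- The derivative in `x` of `x³ + (ξ - x)³`. -/
theorem hasDerivAt_phase (ξ x : ℝ) :
    HasDerivAt (fun x => x ^ 3 + (ξ - x) ^ 3) (3 * x ^ 2 - 3 * (ξ - x) ^ 2) x := by
  have h := ((hasDerivAt_id' x).pow 3).add (((hasDerivAt_id' x).const_sub ξ).pow 3)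
  convert! h using 1
  push_cast
  ring

/-- On a set where the phase is injective and its derivative is at least `δ`, change variables. -/
theorem setLIntegral_comp_phase_le {J : ℝ → ℝ≥0∞} {ξ β δ : ℝ} {s : Set ℝ}
    (hs : MeasurableSet s) (hinj : Set.InjOn (fun x : ℝ => x ^ 3 + (ξ - x) ^ 3) s)
    (hδ : ∀ x ∈ s, δ ≤ |3 * x ^ 2 - 3 * (ξ - x) ^ 2|) :
    ENNReal.ofReal δ * ∫⁻ x in s, J (β - (x ^ 3 + (ξ - x) ^ 3)) ≤ ∫⁻ r, J r := by
  have h := lintegral_image_eq_lintegral_abs_deriv_mul hs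
    (fun x _ => (hasDerivAt_phase ξ x).hasDerivWithinAt) hinj (fun r => J (β - r))
  calc _ ≤ ∫⁻ x in s, ENNReal.ofReal |3 * x ^ 2 - 3 * (ξ - x) ^ 2| *
          J (β - (x ^ 3 + (ξ - x) ^ 3)) := by
        rw [← lintegral_const_mul' _ _ ENNReal.ofReal_ne_top]
        exact setLIntegral_mono' hs fun x hx =>
          mul_le_mul_left (ENNReal.ofReal_le_ofReal (hδ x hx)) _
    _ = _ := h.symm
    _ ≤ ∫⁻ r, J (β - r) := setLIntegral_le_lintegral _ _
    _ = _ := lintegral_sub_left_eq_self J β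

/-- The frequencies at which the phase `x³ + (ξ - x)³` has derivative at least `δ`. -/
def steepSet (ξ δ : ℝ) : Set ℝ := {x | δ ≤ |3 * x ^ 2 - 3 * (ξ - x) ^ 2|}

theorem measurableSet_steepSet (ξ δ : ℝ) : MeasurableSet (steepSet ξ δ) :=
  measurableSet_le (by fun_prop) (by fun_prop)

/-- The cubic terms cancel, so the phase is quadratic in `x` and symmetric about `ξ / 2`. It is
injective on each half of the steep set, and the two halves give the factor 2. -/
theorem setLIntegral_steepSet_le {J : ℝ → ℝ≥0∞} {ξ β δ : ℝ} (hδ : 0 < δ) :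
    ∫⁻ x in steepSet ξ δ, J (β - (x ^ 3 + (ξ - x) ^ 3)) ≤
      2 * (∫⁻ r, J r) / ENNReal.ofReal δ := by
  have hδ' : ENNReal.ofReal δ ≠ 0 := by simpa using hδ
  rw [ENNReal.le_div_iff_mul_le (Or.inl hδ') (Or.inl ENNReal.ofReal_ne_top), mul_comm]
  have hsub : steepSet ξ δ ⊆
      (steepSet ξ δ ∩ {x | ξ / 2 < x}) ∪ (steepSet ξ δ ∩ {x | x < ξ / 2}) := fun x hx => by
    rcases lt_trichotomy x (ξ / 2) with h | h | h
    · exact Or.inr ⟨hx, h⟩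
    · have h1 : δ ≤ |3 * x ^ 2 - 3 * (ξ - x) ^ 2| := hx
      rw [show 3 * x ^ 2 - 3 * (ξ - x) ^ 2 = 0 by rw [h]; ring, abs_zero] at h1
      linarith
    · exact Or.inl ⟨hx, h⟩
  have key : ∀ x ∈ steepSet ξ δ, ∀ y, x ^ 3 + (ξ - x) ^ 3 = y ^ 3 + (ξ - y) ^ 3 →
      x = y ∨ x + y = ξ := fun x hx y h => by
    have h1 : δ ≤ |3 * x ^ 2 - 3 * (ξ - x) ^ 2| := hx
    have hξ : ξ ≠ 0 := by
      rintro rfl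
      rw [show 3 * x ^ 2 - 3 * (0 - x) ^ 2 = 0 by ring, abs_zero] at h1
      linarith
    -- The difference of the phases at `x` and `y` factors in this way.
    have h2 : (3 * ξ) * ((x - y) * (x + y - ξ)) = 0 := by linear_combination h
    rcases mul_eq_zero.1 ((mul_eq_zero.1 h2).resolve_left (by simpa using hξ)) with h3 | h3
    · exact Or.inl (sub_eq_zero.1 h3)
    · exact Or.inr (sub_eq_zero.1 h3)
  have hp := setLIntegral_comp_phase_le (J := J) (ξ := ξ) (β := β) (δ := δ)
    (s := steepSet ξ δ ∩ {x | ξ / 2 < x})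
    ((measurableSet_steepSet ξ δ).inter measurableSet_Ioi) (fun x hx y hy h => by
      rcases key x hx.1 y h with h1 | h1
      · exact h1
      · have := hx.2; have := hy.2; simp only [Set.mem_ofPred_eq] at *; linarith)
    fun x hx => hx.1
  have hm := setLIntegral_comp_phase_le (J := J) (ξ := ξ) (β := β) (δ := δ)
    (s := steepSet ξ δ ∩ {x | x < ξ / 2})
    ((measurableSet_steepSet ξ δ).inter measurableSet_Iio) (fun x hx y hy h => by
      rcases key x hx.1 y h with h1 | h1
      · exact h1
      · have := hx.2; have := hy.2; simp only [Set.mem_ofPred_eq] at *; linarith)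
    fun x hx => hx.1
  calc _ ≤ ENNReal.ofReal δ * (_ + _) := by
        gcongr
        exact (lintegral_mono_set hsub).trans (lintegral_union_le _ _ _)
    _ ≤ _ := by
        rw [mul_add, two_mul]
        exact add_le_add hp hm

/-- The part of the bilinear estimate in which the phase is steep in the variable `x`. -/
theorem lintegral_steep_le {J : ℝ → ℝ≥0∞} (hJ : Measurable J) {ξ δ L : ℝ} (hδ : 0 < δ)
    {φ : ℝ → ℝ} (τ : ℝ) :
    ∫⁻ y in Set.Icc (-L) L, ∫⁻ x in steepSet ξ δ, ∫⁻ s,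
      J s * J (τ - s - (x ^ 3 + (ξ - x) ^ 3) - φ y) ≤
      ENNReal.ofReal (2 * L) * ((∫⁻ r, J r) * (2 * (∫⁻ r, J r) / ENNReal.ofReal δ)) := by
  have h1 : ∀ y, ∫⁻ x in steepSet ξ δ, ∫⁻ s,
      J s * J (τ - s - (x ^ 3 + (ξ - x) ^ 3) - φ y) ≤
      (∫⁻ r, J r) * (2 * (∫⁻ r, J r) / ENNReal.ofReal δ) := fun y => by
    -- With `s` outermost, the bound for the `x` integral is uniform in `s` and `y`.
    rw [lintegral_lintegral_swap (by fun_prop), ← lintegral_mul_const _ hJ]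
    refine lintegral_mono fun s => ?_
    rw [lintegral_const_mul _ (by fun_prop)]
    gcongr
    refine le_trans (le_of_eq ?_) (setLIntegral_steepSet_le (J := J) (ξ := ξ)
      (β := τ - s - φ y) hδ)
    congr 1; ext x; congr 1; ring
  calc _ ≤ ∫⁻ y in Set.Icc (-L) L, (∫⁻ r, J r) * (2 * (∫⁻ r, J r) / ENNReal.ofReal δ) :=
        lintegral_mono fun y => h1 y
    _ = _ := by
        rw [setLIntegral_const, Real.volume_Icc, mul_comm]
        congr 2; ring

/-! ### Resonance bound for separated annuli -/

/-- The spatial frequencies `|ζ| ∼ N` with implied constant `A`. -/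
def annulus (A N : ℝ) : Set Spacetime := {w | A⁻¹ * N ≤ freq w ∧ freq w ≤ A * N}

/-- The square of the reciprocal modulation weight. -/
def decay (b r : ℝ) : ℝ≥0∞ := ENNReal.ofReal (bracket r ^ (-(2 * b)))

@[fun_prop]
theorem continuous_bracket : Continuous bracket := by
  unfold bracket
  fun_prop

theorem one_le_bracket (r : ℝ) : 1 ≤ bracket r :=
  Real.one_le_sqrt.2 (le_add_of_nonneg_right (sq_nonneg r))

theorem bracket_pos (r : ℝ) : 0 < bracket r := one_pos.trans_le (one_le_bracket r)

@[fun_prop]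
theorem continuous_freq : Continuous freq := by
  unfold freq
  fun_prop

@[fun_prop]
theorem continuous_modulation : Continuous modulation := by
  unfold modulation
  fun_prop

theorem measurableSet_annulus (A N : ℝ) : MeasurableSet (annulus A N) :=
  (measurableSet_le measurable_const continuous_freq.measurable).inter
    (measurableSet_le continuous_freq.measurable measurable_const)

@[fun_prop]
theorem measurable_decay (b : ℝ) : Measurable (decay b) := by
  unfold decay
  fun_prop

/-- The weight decays like `|r|^{-2b}`; this is where the positivity of `ε` enters. -/
theorem lintegral_decay_lt_top {b : ℝ} (hb : 1 / 2 < b) : ∫⁻ r, decay b r < ∞ := by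
  have h : Integrable (fun r : ℝ => (1 + ‖r‖ ^ 2) ^ (-(2 * b) / 2)) :=
    integrable_rpow_neg_one_add_norm_sq (by simp; linarith)
  have h1 : ∀ r, decay b r = ENNReal.ofReal ((1 + ‖r‖ ^ 2) ^ (-(2 * b) / 2)) := fun r => by
    rw [decay, bracket, Real.sqrt_eq_rpow, ← Real.rpow_mul (by positivity), Real.norm_eq_abs,
      sq_abs]
    congr 2
    ring
  simp only [h1]
  exact h.lintegral_lt_top

theorem lintegral_indicator_one_mul {α : Type*} [MeasurableSpace α] {μ : Measure α} {s : Set α}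
    (hs : MeasurableSet s) (f : α → ℝ≥0∞) :
    ∫⁻ x, s.indicator (fun _ => 1) x * f x ∂μ = ∫⁻ x in s, f x ∂μ := by
  rw [← lintegral_indicator hs]
  congr 1; ext x
  by_cases hx : x ∈ s <;> simp [hx]

theorem abs_le_of_sqrt_le {x y R : ℝ} (h : Real.sqrt (x ^ 2 + y ^ 2) ≤ R) :
    x ∈ Set.Icc (-R) R ∧ y ∈ Set.Icc (-R) R :=
  ⟨abs_le.1 ((Real.abs_le_sqrt (le_add_of_nonneg_right (sq_nonneg y))).trans h),
    abs_le.1 ((Real.abs_le_sqrt (le_add_of_nonneg_left (sq_nonneg x))).trans h)⟩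

/-- The steepness of the phase, relative to the square of the high frequency. -/
def steepness (A K : ℝ) : ℝ := 3 / 2 * ((A⁻¹) ^ 2 - (A / K) ^ 2)

theorem steepness_pos {A K : ℝ} (hA : 1 ≤ A) (hK : A ^ 2 < K) : 0 < steepness A K := by
  have hA0 : 0 < A := by linarith
  have hK0 : 0 < K := by nlinarith
  have h : A / K < A⁻¹ := by
    rw [div_lt_iff₀ hK0, inv_mul_eq_div, lt_div_iff₀ hA0]
    nlinarith
  have := pow_lt_pow_left₀ h (by positivity) two_ne_zero
  unfold steepness
  linarith

/-- For frequencies of separated sizes, the phase is steep in one of the two variables. -/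
theorem mem_steepSet_or {A K N₁ N₂ a b x y : ℝ} (hA : 1 ≤ A) (hK : A ^ 2 < K) (hN₁ : 0 < N₁)
    (hN : K * N₁ < N₂) (h1 : Real.sqrt (x ^ 2 + y ^ 2) ≤ A * N₁)
    (h2 : A⁻¹ * N₂ ≤ Real.sqrt ((a - x) ^ 2 + (b - y) ^ 2)) :
    x ∈ steepSet a (steepness A K * N₂ ^ 2) ∨ y ∈ steepSet b (steepness A K * N₂ ^ 2) := by
  have hA0 : 0 < A := by linarith
  have hK0 : 0 < K := by nlinarith
  have hN₂ : 0 < N₂ := (mul_pos hK0 hN₁).trans hN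
  have h3 : A * N₁ ≤ A / K * N₂ := by
    rw [div_mul_eq_mul_div, le_div_iff₀ hK0]
    nlinarith
  have h4 : x ^ 2 + y ^ 2 ≤ (A / K * N₂) ^ 2 :=
    (Real.sqrt_le_left (by positivity)).1 (h1.trans h3)
  have h5 : (A⁻¹ * N₂) ^ 2 ≤ (a - x) ^ 2 + (b - y) ^ 2 :=
    (Real.le_sqrt' (by positivity)).1 h2
  by_contra! h
  simp only [steepSet, Set.mem_ofPred_eq, not_le] at h
  -- If neither variable is steep, adding these bounds makes the difference of the squared high and
  -- low frequencies less than `((A⁻¹)² - (A/K)²) N₂²`, against `h4` and `h5`. The `1/2` in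
  -- `steepness` shares this quantity between the two variables.
  have h6 := (abs_lt.1 h.1).1
  have h7 := (abs_lt.1 h.2).1
  unfold steepness at h6 h7
  nlinarith

/-- The convolution of the modulation weights along the line of fixed spatial frequencies. -/
def phaseIntegral (J : ℝ → ℝ≥0∞) (w : Spacetime) (x y : ℝ) : ℝ≥0∞ :=
  ∫⁻ s, J s * J (w 2 - s - (x ^ 3 + (w 0 - x) ^ 3) - (y ^ 3 + (w 1 - y) ^ 3))

theorem measurable_phaseIntegral {J : ℝ → ℝ≥0∞} (hJ : Measurable J) (w : Spacetime) :
    Measurable (Function.uncurry (phaseIntegral J w)) :=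
  Measurable.lintegral_prod_right' (f := fun q : (ℝ × ℝ) × ℝ => J q.2 *
    J (w 2 - q.2 - (q.1.1 ^ 3 + (w 0 - q.1.1) ^ 3) - (q.1.2 ^ 3 + (w 1 - q.1.2) ^ 3)))
    (by fun_prop)

/-- Translating `s` by `x³ + y³` makes it the first modulation and puts the whole phase into the
second. On the support one variable is steep and the other is at most `AN₁` in size, so one of the
two terms on the right already dominates. -/
theorem lintegral_resonance_fiber_le (J : ℝ → ℝ≥0∞) {A K N₁ N₂ : ℝ} (hA : 1 ≤ A)
    (hK : A ^ 2 < K) (hN₁ : 0 < N₁) (hN : K * N₁ < N₂) (w : Spacetime) (x y : ℝ) :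
    ∫⁻ s,
      ((annulus A N₁).indicator (fun _ => 1) !₂[x, y, s] * J (modulation !₂[x, y, s])) *
      ((annulus A N₂).indicator (fun _ => 1) (w - !₂[x, y, s]) * J (modulation (w - !₂[x, y, s])))
      ≤ (steepSet (w 0) (steepness A K * N₂ ^ 2)).indicator (fun _ => 1) x *
          ((Set.Icc (-(A * N₁)) (A * N₁)).indicator (fun _ => 1) y * phaseIntegral J w x y) +
        (Set.Icc (-(A * N₁)) (A * N₁)).indicator (fun _ => 1) x *
          ((steepSet (w 1) (steepness A K * N₂ ^ 2)).indicator (fun _ => 1) y * phaseIntegral J w x y) := by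
  have hf1 : ∀ s, freq !₂[x, y, s] = Real.sqrt (x ^ 2 + y ^ 2) := fun s => by simp [freq]
  have hf2 : ∀ s, freq (w - !₂[x, y, s]) = Real.sqrt ((w 0 - x) ^ 2 + (w 1 - y) ^ 2) :=
    fun s => by simp [freq]
  by_cases h : Real.sqrt (x ^ 2 + y ^ 2) ≤ A * N₁ ∧
      A⁻¹ * N₂ ≤ Real.sqrt ((w 0 - x) ^ 2 + (w 1 - y) ^ 2)
  · have h1 : ∫⁻ s,
        ((annulus A N₁).indicator (fun _ => 1) !₂[x, y, s] * J (modulation !₂[x, y, s])) *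
        ((annulus A N₂).indicator (fun _ => 1) (w - !₂[x, y, s]) *
          J (modulation (w - !₂[x, y, s]))) ≤ phaseIntegral J w x y := by
      rw [phaseIntegral, ← lintegral_sub_right_eq_self (fun s => J s *
        J (w 2 - s - (x ^ 3 + (w 0 - x) ^ 3) - (y ^ 3 + (w 1 - y) ^ 3))) (x ^ 3 + y ^ 3)]
      refine lintegral_mono fun s => ?_
      have hle : ∀ (S : Set Spacetime) (z : Spacetime), S.indicator (fun _ => (1 : ℝ≥0∞)) z ≤ 1 :=
        fun S z => Set.indicator_le_self' (fun _ _ => zero_le) z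
      refine (mul_le_mul' (mul_le_mul_left (hle _ _) _) (mul_le_mul_left (hle _ _) _)).trans_eq ?_
      rw [one_mul, one_mul]
      simp only [modulation, PiLp.sub_apply]
      simp
      congr 2
      ring
    obtain ⟨hx, hy⟩ := abs_le_of_sqrt_le h.1
    rcases mem_steepSet_or hA hK hN₁ hN h.1 h.2 with h2 | h2
    · refine h1.trans (le_add_right (le_of_eq ?_))
      rw [Set.indicator_of_mem h2, Set.indicator_of_mem hy, one_mul, one_mul]
    · refine h1.trans (le_add_left (le_of_eq ?_))
      rw [Set.indicator_of_mem h2, Set.indicator_of_mem hx, one_mul, one_mul]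
  · have h0 : ∀ s, ((annulus A N₁).indicator (fun _ => (1 : ℝ≥0∞)) !₂[x, y, s] *
        J (modulation !₂[x, y, s])) * ((annulus A N₂).indicator (fun _ => 1) (w - !₂[x, y, s]) *
          J (modulation (w - !₂[x, y, s]))) = 0 := fun s => by
      rw [not_and_or] at h
      rcases h with h | h
      · rw [Set.indicator_of_notMem (fun hc => h (by rw [← hf1 s]; exact hc.2))]; simp
      · rw [Set.indicator_of_notMem (s := annulus A N₂)
          (fun hc => h (by rw [← hf2 s]; exact hc.1))]; simp
    simp only [h0, lintegral_zero]
    exact zero_le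
-- Tonelli, arranged so that in each term the steep variable is integrated first.
theorem lintegral_indicator_add_indicator {Φ : ℝ → ℝ → ℝ≥0∞}
    (hΦ : Measurable (Function.uncurry Φ)) {E₀ E₁ I : Set ℝ} (hE₀ : MeasurableSet E₀)
    (hE₁ : MeasurableSet E₁) (hI : MeasurableSet I) :
    ∫⁻ x, ∫⁻ y, (E₀.indicator (fun _ => 1) x * (I.indicator (fun _ => 1) y * Φ x y) +
      I.indicator (fun _ => 1) x * (E₁.indicator (fun _ => 1) y * Φ x y)) =
      (∫⁻ y in I, ∫⁻ x in E₀, Φ x y) + ∫⁻ x in I, ∫⁻ y in E₁, Φ x y := by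
  have hi₁ : Measurable (E₁.indicator (fun _ => (1 : ℝ≥0∞))) := measurable_const.indicator hE₁
  have hiI : Measurable (I.indicator (fun _ => (1 : ℝ≥0∞))) := measurable_const.indicator hI
  have hi₀ : Measurable (E₀.indicator (fun _ => (1 : ℝ≥0∞))) := measurable_const.indicator hE₀
  have hΦ1 : ∀ x, Measurable (Φ x) := fun x => hΦ.comp measurable_prodMk_left
  have hsection : ∀ x, ∫⁻ y, (E₀.indicator (fun _ => 1) x * (I.indicator (fun _ => 1) y * Φ x y) +
      I.indicator (fun _ => 1) x * (E₁.indicator (fun _ => 1) y * Φ x y)) =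
      E₀.indicator (fun _ => 1) x * (∫⁻ y in I, Φ x y) +
        I.indicator (fun _ => 1) x * ∫⁻ y in E₁, Φ x y := fun x => by
    have := hΦ1 x
    rw [lintegral_add_left (by fun_prop), lintegral_const_mul _ (by fun_prop), lintegral_const_mul _ (by fun_prop),
      lintegral_indicator_one_mul hI, lintegral_indicator_one_mul hE₁]
  have hm : Measurable fun x => ∫⁻ y in I, Φ x y := hΦ.lintegral_prod_right'
  rw [lintegral_congr hsection, lintegral_add_left (by fun_prop),
    lintegral_indicator_one_mul hE₀, lintegral_indicator_one_mul hI,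
    lintegral_lintegral_swap hΦ.aemeasurable]

/-- The bound for the convolution of the two modulation weights, restricted to frequencies of
separated sizes. -/
theorem lintegral_resonance_le {J : ℝ → ℝ≥0∞} (hJ : Measurable J) {A K N₁ N₂ : ℝ} (hA : 1 ≤ A)
    (hK : A ^ 2 < K) (hN₁ : 0 < N₁) (hN : K * N₁ < N₂) (w : Spacetime) :
    ∫⁻ t, ((annulus A N₁).indicator (fun _ => 1) t * J (modulation t)) *
      ((annulus A N₂).indicator (fun _ => 1) (w - t) * J (modulation (w - t))) ≤
      2 * (ENNReal.ofReal (2 * (A * N₁)) * ((∫⁻ r, J r) *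
        (2 * (∫⁻ r, J r) / ENNReal.ofReal (steepness A K * N₂ ^ 2)))) := by
  have hN₂ : 0 < N₂ := (mul_pos (by nlinarith) hN₁).trans hN
  have hδ : 0 < steepness A K * N₂ ^ 2 := mul_pos (steepness_pos hA hK) (by positivity)
  have hm1 : Measurable ((annulus A N₁).indicator (fun _ => (1 : ℝ≥0∞))) :=
    measurable_const.indicator (measurableSet_annulus A N₁)
  have hm2 : Measurable ((annulus A N₂).indicator (fun _ => (1 : ℝ≥0∞))) :=
    measurable_const.indicator (measurableSet_annulus A N₂)
  rw [lintegral_spacetime (by fun_prop)]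
  refine (lintegral_mono fun x => lintegral_mono fun y =>
    lintegral_resonance_fiber_le J hA hK hN₁ hN w x y).trans ?_
  rw [lintegral_indicator_add_indicator (measurable_phaseIntegral hJ w)
    (measurableSet_steepSet _ _) (measurableSet_steepSet _ _) measurableSet_Icc, two_mul]
  refine add_le_add
    (lintegral_steep_le hJ hδ (φ := fun y => y ^ 3 + (w 1 - y) ^ 3) (w 2)) ?_
  -- The second term is the first with the roles of `x` and `y` exchanged.
  refine le_of_eq_of_le ?_
    (lintegral_steep_le hJ (ξ := w 1) hδ (φ := fun x => x ^ 3 + (w 0 - x) ^ 3) (w 2))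
  refine lintegral_congr fun x => lintegral_congr fun y => lintegral_congr fun s => ?_
  rw [sub_right_comm]

/-- The reciprocal modulation weight is square integrable over bounded spatial frequencies. -/
theorem lintegral_annulus_decay_lt_top {J : ℝ → ℝ≥0∞} (hJ : Measurable J) (hJ' : ∫⁻ r, J r < ∞)
    (A N : ℝ) : ∫⁻ t, (annulus A N).indicator (fun _ => 1) t * J (modulation t) < ∞ := by
  have hm1 : Measurable ((annulus A N).indicator (fun _ => (1 : ℝ≥0∞))) :=
    measurable_const.indicator (measurableSet_annulus A N)
  rw [lintegral_spacetime (by fun_prop)]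
  set I : Set ℝ := Set.Icc (-(A * N)) (A * N)
  have hI : MeasurableSet I := measurableSet_Icc
  have key : ∀ x y : ℝ, ∫⁻ s, (annulus A N).indicator (fun _ => 1) !₂[x, y, s] *
      J (modulation !₂[x, y, s]) ≤
      I.indicator (fun _ => 1) x * (I.indicator (fun _ => 1) y * ∫⁻ r, J r) := fun x y => by
    by_cases h : Real.sqrt (x ^ 2 + y ^ 2) ≤ A * N
    · obtain ⟨hx, hy⟩ := abs_le_of_sqrt_le h
      rw [Set.indicator_of_mem hx, Set.indicator_of_mem hy, one_mul, one_mul,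
        ← lintegral_sub_right_eq_self J (x ^ 3 + y ^ 3)]
      refine lintegral_mono fun s => ?_
      refine (mul_le_mul_left (Set.indicator_le_self' (fun _ _ => zero_le) _) _).trans_eq ?_
      rw [one_mul]
      simp [modulation]
    · have h0 : ∀ s, (annulus A N).indicator (fun _ => (1 : ℝ≥0∞)) !₂[x, y, s] *
          J (modulation !₂[x, y, s]) = 0 := fun s => by
        rw [Set.indicator_of_notMem, zero_mul]
        intro hc
        exact h (by simpa [freq] using hc.2)
      simp only [h0, lintegral_zero]
      exact zero_le
  refine (lintegral_mono fun x => lintegral_mono fun y => key x y).trans_lt ?_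
  have : ∀ x, ∫⁻ y, I.indicator (fun _ => 1) x * (I.indicator (fun _ => 1) y * ∫⁻ r, J r) =
      I.indicator (fun _ => 1) x * ((∫⁻ r, J r) * volume I) := fun x => by
    rw [lintegral_const_mul _ ((measurable_const.indicator hI).mul_const _),
      lintegral_indicator_one_mul hI, setLIntegral_const]
  simp only [this]
  rw [lintegral_indicator_one_mul hI, setLIntegral_const]
  have hv : volume I < ∞ := measure_Icc_lt_top
  exact ENNReal.mul_lt_top (ENNReal.mul_lt_top hJ' hv) hv

/-! ### Bilinear estimate on the frequency side -/

/-- The norm `‖⟨τ - (ξ³ + η³)⟩^b G‖_{L²}` of a function on the frequency side. -/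
def modulationNorm (b : ℝ) (G : Spacetime → ℂ) : ℝ≥0∞ :=
  eLpNorm (fun w => ((bracket (modulation w) ^ b : ℝ) : ℂ) * G w) 2 volume

/-- The reciprocal modulation weight restricted to an annulus. -/
def annulusWeight (A N b : ℝ) (w : Spacetime) : ℝ≥0∞ :=
  (annulus A N).indicator (fun _ => 1) w * ENNReal.ofReal (bracket (modulation w) ^ (-b))

theorem measurable_bracket_modulation_rpow (b : ℝ) :
    Measurable fun w : Spacetime => bracket (modulation w) ^ b := by
  have := continuous_modulation.measurable
  have := continuous_bracket.measurable
  fun_prop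

@[fun_prop]
theorem measurable_annulusWeight (A N b : ℝ) : Measurable (annulusWeight A N b) :=
  (measurable_const.indicator (measurableSet_annulus A N)).mul
    (measurable_bracket_modulation_rpow (-b)).ennreal_ofReal

theorem annulusWeight_sq (A N b : ℝ) (w : Spacetime) : annulusWeight A N b w ^ 2 =
    (annulus A N).indicator (fun _ => 1) w * decay b (modulation w) := by
  have h1 : ENNReal.ofReal (bracket (modulation w) ^ (-b)) ^ 2 = decay b (modulation w) := by
    have := bracket_pos (modulation w)
    rw [decay, ← ENNReal.ofReal_pow (by positivity), ← Real.rpow_natCast, ← Real.rpow_mul this.le]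
    congr 2
    push_cast
    ring
  rw [annulusWeight, mul_pow, h1]
  by_cases h : w ∈ annulus A N <;> simp [h]

/-- The factorization of `G` used both for its integrability and for the weighted convolution bound.
-/
theorem enorm_le_annulusWeight_mul {A N : ℝ} (b : ℝ) {G : Spacetime → ℂ}
    (hG : ∀ w, w ∉ annulus A N → G w = 0) (w : Spacetime) :
    ‖G w‖ₑ ≤ annulusWeight A N b w * ‖((bracket (modulation w) ^ b : ℝ) : ℂ) * G w‖ₑ := by
  by_cases h : w ∈ annulus A N
  · have hp := bracket_pos (modulation w)
    have h1 : ‖((bracket (modulation w) ^ b : ℝ) : ℂ)‖ₑ =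
        ENNReal.ofReal (bracket (modulation w) ^ b) := by
      rw [← ofReal_norm, Complex.norm_real, Real.norm_of_nonneg (by positivity)]
    rw [annulusWeight, Set.indicator_of_mem h, one_mul, enorm_mul, h1, ← mul_assoc,
      ← ENNReal.ofReal_mul (by positivity), ← Real.rpow_add hp]
    simp
  · simp [hG w h]

theorem measurable_enorm_weight_mul {G : Spacetime → ℂ} (hG : Measurable G) (b : ℝ) :
    Measurable fun w => ‖((bracket (modulation w) ^ b : ℝ) : ℂ) * G w‖ₑ :=
  ((Complex.measurable_ofReal.comp (measurable_bracket_modulation_rpow b)).mul hG).enorm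

/-- A function of finite weighted norm supported in an annulus is integrable. -/
theorem integrable_of_modulationNorm_lt_top {A N b : ℝ} (hb : 1 / 2 < b) {G : Spacetime → ℂ}
    (hGm : Measurable G) (hG : ∀ w, w ∉ annulus A N → G w = 0)
    (hn : modulationNorm b G < ∞) : Integrable G := by
  refine ⟨hGm.aestronglyMeasurable, ?_⟩
  refine (lintegral_mono (enorm_le_annulusWeight_mul b hG)).trans_lt ?_
  have h := lintegral_mul_sq_le volume (measurable_annulusWeight A N b).aemeasurable
    (measurable_enorm_weight_mul hGm b).aemeasurable
  rw [← eLpNorm_two_sq] at h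
  simp only [annulusWeight_sq] at h
  have h2 := h.trans_lt (ENNReal.mul_lt_top (lintegral_annulus_decay_lt_top (measurable_decay b)
    (lintegral_decay_lt_top hb) A N) (ENNReal.pow_lt_top hn))
  exact (ENNReal.pow_lt_top_iff.1 h2).resolve_right two_ne_zero

/-- The bilinear estimate on the frequency side. -/
theorem exists_bilinear_bound {A K b : ℝ} (hA : 1 ≤ A) (hK : A ^ 2 < K) (hb : 1 / 2 < b) :
    ∃ C : ℝ, 0 < C ∧ ∀ N₁ N₂ : ℝ, 0 < N₁ → K * N₁ < N₂ → ∀ G H : Spacetime → ℂ,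
      Measurable G → Measurable H → (∀ w, w ∉ annulus A N₁ → G w = 0) →
      (∀ w, w ∉ annulus A N₂ → H w = 0) → modulationNorm b G < ∞ → modulationNorm b H < ∞ →
      eLpNorm (fun p => invFourier G p * invFourier H p) 2 volume ≤
        ENNReal.ofReal (C * (N₁ ^ (1 / 2 : ℝ) / N₂)) * modulationNorm b G *
          modulationNorm b H := by
  set j : ℝ := (∫⁻ r, decay b r).toReal
  have hj : ∫⁻ r, decay b r = ENNReal.ofReal j :=
    (ENNReal.ofReal_toReal (lintegral_decay_lt_top hb).ne).symm
  have hj0 : 0 ≤ j := ENNReal.toReal_nonneg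
  have hA0 : 0 < A := by linarith
  have hσ := steepness_pos hA hK
  set σ := steepness A K with hσ_def
  -- The first term collects the constants of `lintegral_resonance_le`; adding 1 gives positivity
  -- without a lower bound on `j`.
  have hC0 : 0 < 8 * A * j ^ 2 / σ + 1 := by positivity
  refine ⟨Real.sqrt (8 * A * j ^ 2 / σ + 1), Real.sqrt_pos.2 hC0, ?_⟩
  intro N₁ N₂ hN₁ hN G H hGm hHm hG hH hGn hHn
  have hN₂ : 0 < N₂ := (mul_pos (by nlinarith) hN₁).trans hN
  refine (eLpNorm_invFourier_mul_le (integrable_of_modulationNorm_lt_top hb hGm hG hGn)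
    (integrable_of_modulationNorm_lt_top hb hHm hH hHn)).trans ?_
  rw [← ENNReal.pow_le_pow_left_iff two_ne_zero]
  have hM : ∀ w, ∫⁻ t, annulusWeight A N₁ b t ^ 2 * annulusWeight A N₂ b (w - t) ^ 2 ≤
      ENNReal.ofReal (Real.sqrt (8 * A * j ^ 2 / σ + 1) * (N₁ ^ (1 / 2 : ℝ) / N₂)) ^ 2 :=
    fun w => by
    simp only [annulusWeight_sq]
    refine (lintegral_resonance_le (measurable_decay b) hA hK hN₁ hN w).trans ?_
    rw [hj, ← hσ_def, ← ENNReal.ofReal_pow (by positivity), ← ENNReal.ofReal_ofNat 2,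
      ← ENNReal.ofReal_mul (by norm_num), ← ENNReal.ofReal_div_of_pos (by positivity),
      ← ENNReal.ofReal_mul (by positivity), ← ENNReal.ofReal_mul (by positivity),
      ← ENNReal.ofReal_mul (by positivity)]
    refine ENNReal.ofReal_le_ofReal ?_
    rw [mul_pow, div_pow, Real.sq_sqrt hC0.le, ← Real.sqrt_eq_rpow, Real.sq_sqrt hN₁.le]
    have : 2 * (2 * (A * N₁) * (j * (2 * j / (σ * N₂ ^ 2)))) =
        8 * A * j ^ 2 / σ * (N₁ / N₂ ^ 2) := by
      field_simp
      ring
    rw [this]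
    gcongr
    linarith
  have h := lintegral_convolution_sq_le (measurable_annulusWeight A N₁ b)
    (measurable_annulusWeight A N₂ b) (measurable_enorm_weight_mul hGm b)
    (measurable_enorm_weight_mul hHm b) (enorm_le_annulusWeight_mul b hG)
    (enorm_le_annulusWeight_mul b hH) hM
  rw [← eLpNorm_two_sq, ← eLpNorm_two_sq] at h
  rw [mul_pow, mul_pow, mul_assoc]
  exact h

/-! ### Localized distributions and their fractional derivatives -/

/-- A frequency-localized element of `X_{0,b}` has a measurable Fourier transform that vanishes
off the annulus. -/
theorem exists_measurable_representative {A N b : ℝ} {u : 𝓢'(Spacetime, ℂ)}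
    (hu : u ∈ bourgainSpace 0 b) (hs : FreqSupported A N u) :
    ∃ G : Spacetime → ℂ, Measurable G ∧ (∀ w, w ∉ annulus A N → G w = 0) ∧
      IsFunction (fourierDist u) G ∧ modulationNorm b G = bourgainNorm 0 b u ∧
      modulationNorm b G < ∞ := by
  obtain ⟨G₀, hG₀⟩ := exists_isFunction_of_mem_bourgainSpace hu
  -- Truncation changes `G₀` only on a null set, since `F(u)` is supported in the annulus.
  set G : Spacetime → ℂ := (annulus A N).indicator (hG₀.1.mk G₀) with hG_def
  have hae : G₀ =ᵐ[volume] G := by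
    filter_upwards [hG₀.1.ae_eq_mk, hG₀.ae_eq_zero] with w h1 h2
    by_cases h : w ∈ annulus A N
    · rw [hG_def, Set.indicator_of_mem h, h1]
    · rw [hG_def, Set.indicator_of_notMem h]
      exact h2 fun h3 => h (hs h3)
  have hG : IsFunction (fourierDist u) G := hG₀.congr hae
  have hn : modulationNorm b G = bourgainNorm 0 b u := by
    rw [bourgainNorm_eq hG, modulationNorm]
    simp
  exact ⟨G, hG₀.1.stronglyMeasurable_mk.measurable.indicator (measurableSet_annulus A N),
    fun w hw => Set.indicator_of_notMem hw _, hG, hn, hn ▸ hu⟩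

theorem modulationNorm_freq_mul_le {A N b α c : ℝ} {G : Spacetime → ℂ}
    (hG : ∀ w, w ∉ annulus A N → G w = 0) (hc : ∀ w ∈ annulus A N, freq w ^ α ≤ c) :
    modulationNorm b (fun w => ((freq w ^ α : ℝ) : ℂ) * G w) ≤
      ENNReal.ofReal c * modulationNorm b G := by
  refine eLpNorm_le_mul_eLpNorm_of_ae_le_mul (Filter.Eventually.of_forall fun w => ?_) 2
  by_cases h : w ∈ annulus A N
  · have h1 : 0 ≤ freq w ^ α := Real.rpow_nonneg (Real.sqrt_nonneg _) _
    rw [mul_left_comm, norm_mul, Complex.norm_real, Real.norm_of_nonneg h1]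
    exact mul_le_mul_of_nonneg_right (hc w h) (norm_nonneg _)
  · simp [hG w h]

/-- Fractional derivatives of distributions with Fourier transform supported in an annulus. -/
theorem exists_fracDeriv {A N b α c : ℝ} (hb : 1 / 2 < b) {u : 𝓢'(Spacetime, ℂ)}
    {G : Spacetime → ℂ} (hGm : Measurable G) (hG : ∀ w, w ∉ annulus A N → G w = 0)
    (hu : IsFunction (fourierDist u) G) (hn : modulationNorm b G < ∞)
    (hc : ∀ w ∈ annulus A N, freq w ^ α ≤ c) :
    ∃ (u' : 𝓢'(Spacetime, ℂ)) (G' : Spacetime → ℂ), IsFracDeriv α u u' ∧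
      IsFunction u' (invFourier G') ∧ Measurable G' ∧ (∀ w, w ∉ annulus A N → G' w = 0) ∧
      modulationNorm b G' < ∞ ∧ modulationNorm b G' ≤ ENNReal.ofReal c * modulationNorm b G := by
  set G' : Spacetime → ℂ := fun w => ((freq w ^ α : ℝ) : ℂ) * G w with hG'_def
  have hm : Measurable G' :=
    (Complex.measurable_ofReal.comp (continuous_freq.measurable.pow_const α)).mul hGm
  have hG' : ∀ w, w ∉ annulus A N → G' w = 0 := fun w hw => by simp [hG'_def, hG w hw]
  have hle := modulationNorm_freq_mul_le (b := b) hG hc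
  have hlt : modulationNorm b G' < ∞ := hle.trans_lt (ENNReal.mul_lt_top ENNReal.ofReal_lt_top hn)
  have hi := integrable_of_modulationNorm_lt_top hb hm hG' hlt
  obtain ⟨u', hu'⟩ := exists_fourierDist_isFunction hi
  exact ⟨u', G', ⟨G, hu, hu'⟩, hu'.of_fourierDist hi, hm, hG', hlt, hle⟩

end ZK

end

/-! ### The two estimates -/

theorem lemma4p1 (ε : ℝ) (hε : 0 < ε) (A : ℝ) (hA : 1 ≤ A) (K : ℝ) (hK : A ^ 2 < K) :
    ∃ C : ℝ, 0 < C ∧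
      ∀ (N₁ N₂ : ℝ), 0 < N₁ → K * N₁ < N₂ →
      ∀ u ∈ ZK.bourgainSpace 0 (1 / 2 + ε), ∀ v ∈ ZK.bourgainSpace 0 (1 / 2 + ε),
        ZK.FreqSupported A N₁ u → ZK.FreqSupported A N₂ v →
        (∃ (u' v' : TemperedDistribution ZK.Spacetime ℂ) (f g : ZK.Spacetime → ℂ),
          ZK.IsFracDeriv (-1 / 2) u u' ∧ ZK.IsFunction u' f ∧
          ZK.IsFracDeriv 1 v v' ∧ ZK.IsFunction v' g ∧
          eLpNorm (fun p => f p * g p) 2 volume ≤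
            ENNReal.ofReal C *
              ZK.bourgainNorm 0 (1 / 2 + ε) u * ZK.bourgainNorm 0 (1 / 2 + ε) v) ∧
        (∃ f g : ZK.Spacetime → ℂ,
          ZK.IsFunction u f ∧ ZK.IsFunction v g ∧
          eLpNorm (fun p => f p * g p) 2 volume ≤
            ENNReal.ofReal (C * (N₁ ^ (1 / 2 : ℝ) / N₂)) *
              ZK.bourgainNorm 0 (1 / 2 + ε) u * ZK.bourgainNorm 0 (1 / 2 + ε) v) := by
  have hb : 1 / 2 < 1 / 2 + ε := by linarith
  obtain ⟨C, hC, hbound⟩ := ZK.exists_bilinear_bound hA hK hb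
  have hA0 : 0 < A := by linarith
  have hAA : 1 ≤ A ^ (1 / 2 : ℝ) * A := one_le_mul_of_one_le_of_one_le
    (Real.one_le_rpow hA (by norm_num)) hA
  -- On the annuli `|ζ|^{-1/2} ≤ A^{1/2} N₁^{-1/2}` and `|ζ| ≤ A N₂`, which costs `A^{1/2} · A` in
  -- the first estimate; this is at least 1, so the same constant serves the second.
  refine ⟨C * (A ^ (1 / 2 : ℝ) * A), by positivity, ?_⟩
  intro N₁ N₂ hN₁ hN u hu v hv hsu hsv
  have hN₂ : 0 < N₂ := (mul_pos (by nlinarith) hN₁).trans hN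
  obtain ⟨G, hGm, hG, huG, hnu, hGn⟩ := ZK.exists_measurable_representative hu hsu
  obtain ⟨H, hHm, hH, hvH, hnv, hHn⟩ := ZK.exists_measurable_representative hv hsv
  rw [← hnu, ← hnv]
  constructor
  · obtain ⟨u', G', hd, hf, hGm', hG', hGn', hGle⟩ := ZK.exists_fracDeriv (α := -1 / 2)
      (c := (A⁻¹ * N₁) ^ (-1 / 2 : ℝ)) hb hGm hG huG hGn fun w hw =>
        Real.rpow_le_rpow_of_nonpos (by positivity) hw.1 (by norm_num)
    obtain ⟨v', H', hd', hf', hHm', hH', hHn', hHle⟩ := ZK.exists_fracDeriv (α := 1)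
      (c := A * N₂) hb hHm hH hvH hHn fun w hw => by rw [Real.rpow_one]; exact hw.2
    refine ⟨u', v', _, _, hd, hf, hd', hf', ?_⟩
    refine (hbound N₁ N₂ hN₁ hN G' H' hGm' hHm' hG' hH' hGn' hHn').trans ?_
    refine (mul_le_mul' (mul_le_mul_right hGle _) hHle).trans_eq ?_
    have hp : N₁ ^ (1 / 2 : ℝ) * (A⁻¹ * N₁) ^ (-1 / 2 : ℝ) = A ^ (1 / 2 : ℝ) := by
      rw [Real.mul_rpow (by positivity) hN₁.le, Real.inv_rpow hA0.le,
        ← Real.rpow_neg hA0.le, mul_left_comm, ← Real.rpow_add hN₁]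
      norm_num
    have hconst : C * (A ^ (1 / 2 : ℝ) * A) =
        C * (N₁ ^ (1 / 2 : ℝ) / N₂) * (A⁻¹ * N₁) ^ (-1 / 2 : ℝ) * (A * N₂) := by
      rw [← hp]
      field_simp
    rw [hconst, ENNReal.ofReal_mul (q := A * N₂) (by positivity),
      ENNReal.ofReal_mul (q := (A⁻¹ * N₁) ^ (-1 / 2 : ℝ)) (by positivity)]
    ring
  · refine ⟨_, _, huG.of_fourierDist (ZK.integrable_of_modulationNorm_lt_top hb hGm hG hGn),
      hvH.of_fourierDist (ZK.integrable_of_modulationNorm_lt_top hb hHm hH hHn), ?_⟩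
    refine (hbound N₁ N₂ hN₁ hN G H hGm hHm hG hH hGn hHn).trans ?_
    gcongr
    exact le_mul_of_one_le_right hC.le hAA
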